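/- Let $m,n\ge 1$ and $r\ge 1$ be integers, let $M\in\mathbb{R}^{m\times n}\setminus\{0\}$, and suppose that $M$ has at least $r$ zero rows or at least $r$ zero columns. Let $f:\mathbb{R}^{m\times r}\times\mathbb{R}^{n\times r}\to\mathbb{R}$ be defined by $f(X,Y):=\|XY^T-M\|_1$, where $\|\cdot\|_1$ is the entrywise $\ell_1$-norm and the domain carries the Euclidean (Frobenius) inner product. Then $f$ admits strongly unstable spurious local minima. More precisely, the following points $(X^*,Y^*)$ are strongly unstable spurious local minima of $f$: - if $r$ given distinct rows of $M$ are zero: every point such that the corresponding $r$ rows of $X^*$ form an invertible $r\times r$ matrix, the remaining rows of $X^*$ are zero, and $Y^*=0$; - if $r$ given distinct columns of $M$ are zero: every point such that the corresponding $r$ rows of $Y^*$ form an invertible $r\times r$ matrix, the remaining rows of $Y^*$ are zero, and $X^*=0$. Here a local minimum $x^*$ of $f$ is *spurious* if $f(x^*)>\inf f$. The Clarke subdifferential of a locally Lipschitz function $f$ is $\partial f(x):=\{s:\ \langle s,d\rangle\le f^\circ(x,d)\ \text{for all } d\}$, where $f^\circ(x,d):=\limsup_{y\to x,\ t\searrow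 0}\frac{f(y+td)-f(y)}{t}$. The subgradient method with constant step size $\alpha>0$ generates, from $x_0$, the sequences with $x_{k+1}\in x_k-\alpha\,\partial f(x_k)$ for all $k\in\mathbb{N}$. A point $x^*$ is *strongly unstable* for a locally Lipschitz function $f$ if there exists $\epsilon>0$ such that, for all but finitely many $\alpha>0$ and for Lebesgue-almost every $x_0$ in the closed ball $B(x^*,\epsilon)$, every sequence generated by the subgradient method with step size $\alpha$ from $x_0$ has at least one term outside $B(x^*,\epsilon)$. -/

import Mathlib

open Filter Topology MeasureTheory

noncomputable section

/-- The Clarke generalized directional derivative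
`f°(x, d) = limsup_{y → x, t ↘ 0} (f (y + t d) - f y) / t`, taken in the extended reals
(for a locally Lipschitz function it is a real number). -/
def clarkeDirDeriv {ι : Type*} [Fintype ι] (f : EuclideanSpace ℝ ι → ℝ)
    (x d : EuclideanSpace ℝ ι) : EReal :=
  limsup (fun p : EuclideanSpace ℝ ι × ℝ => (((f (p.1 + p.2 • d) - f p.1) / p.2 : ℝ) : EReal))
    (𝓝 x ×ˢ 𝓝[>] (0 : ℝ))

/-- The Clarke subdifferential `∂f(x) = {s | ∀ d, ⟨s, d⟩ ≤ f°(x, d)}`. -/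
def clarkeSubdifferential {ι : Type*} [Fintype ι] (f : EuclideanSpace ℝ ι → ℝ)
    (x : EuclideanSpace ℝ ι) : Set (EuclideanSpace ℝ ι) :=
  {s | ∀ d : EuclideanSpace ℝ ι, ((inner ℝ s d : ℝ) : EReal) ≤ clarkeDirDeriv f x d}

/-- `x 0, x 1, …` is generated by the subgradient method with constant step size `α`:
`x (k + 1) ∈ x k - α ∂f(x k)` for all `k`. -/
def IsSubgradientSequence {ι : Type*} [Fintype ι] (f : EuclideanSpace ℝ ι → ℝ) (α : ℝ)
    (x : ℕ → EuclideanSpace ℝ ι) : Prop :=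
  ∀ k : ℕ, ∃ s ∈ clarkeSubdifferential f (x k), x (k + 1) = x k - α • s

/-- `f` is locally Lipschitz, and there is `ε > 0` such that for all but finitely many step sizes
`α > 0` and for almost every initial point in the closed ball `B(xs, ε)`, every sequence generated
by the subgradient method has an iterate outside of `B(xs, ε)`. -/
def IsStronglyUnstable {ι : Type*} [Fintype ι] (f : EuclideanSpace ℝ ι → ℝ)
    (xs : EuclideanSpace ℝ ι) : Prop :=
  LocallyLipschitz f ∧
  ∃ ε : ℝ, 0 < ε ∧
    {α : ℝ | 0 < α ∧
      ¬ ∀ᵐ x₀ : EuclideanSpace ℝ ι, x₀ ∈ Metric.closedBall xs ε →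
        ∀ x : ℕ → EuclideanSpace ℝ ι, x 0 = x₀ → IsSubgradientSequence f α x →
          ∃ k : ℕ, x k ∉ Metric.closedBall xs ε}.Finite

/-- A local minimum `xs` of `f` with `f xs > inf f`. -/
def IsSpuriousLocalMin {ι : Type*} [Fintype ι] (f : EuclideanSpace ℝ ι → ℝ)
    (xs : EuclideanSpace ℝ ι) : Prop :=
  IsLocalMin f xs ∧ ∃ y, f y < f xs

/-- The space `ℝ^{m×r} × ℝ^{n×r}` with the Euclidean (Frobenius) inner product. -/
abbrev FactorSpace (m n r : ℕ) : Type :=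
  EuclideanSpace ℝ ((Fin m × Fin r) ⊕ (Fin n × Fin r))

/-- The first component `X` of a point `(X, Y)`. -/
def factorX {m n r : ℕ} (z : FactorSpace m n r) : Matrix (Fin m) (Fin r) ℝ :=
  Matrix.of fun i k => z (Sum.inl (i, k))

/-- The second component `Y` of a point `(X, Y)`. -/
def factorY {m n r : ℕ} (z : FactorSpace m n r) : Matrix (Fin n) (Fin r) ℝ :=
  Matrix.of fun j k => z (Sum.inr (j, k))

/-- The point `(X, Y)`. -/
def factorPair {m n r : ℕ} (X : Matrix (Fin m) (Fin r) ℝ) (Y : Matrix (Fin n) (Fin r) ℝ) :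
    FactorSpace m n r :=
  WithLp.toLp 2 (Sum.elim (fun p => X p.1 p.2) (fun p => Y p.1 p.2))

/-- The robust PCA objective `f(X, Y) = ‖X Yᵀ - M‖₁`, with the entrywise `ℓ₁`-norm. -/
def rpcaObjective {m n r : ℕ} (M : Matrix (Fin m) (Fin n) ℝ) (z : FactorSpace m n r) : ℝ :=
  ∑ i, ∑ j, |(factorX z * (factorY z).transpose - M) i j|

end

/-!
Near a point where no entry of `X Yᵀ - M` vanishes, the objective is a quadratic function, whose
gradient is `L (X, Y) = (Λ Y, Λᵀ X)` for the sign matrix `Λ` of `X Yᵀ - M`. The map `L` is symmetric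
and anticommutes with `J (X, Y) = (X, -Y)`. Hence a step `z ↦ z - α L z` changes the quadratic form
`⟨J z, z⟩ = ‖X‖² - ‖Y‖²`, which gradient flow would conserve, exactly by
`α² ⟨J L z, L z⟩ = α² (‖Λ Y‖² - ‖Λᵀ X‖²)` (`inner_step_of_anticommute`).

At a point `(X*, 0)` as in the statement this is `-α² ‖Λᵀ X*‖²`, and `Λᵀ X* ≠ 0` for every matrix `Λ`
with entries `±1`, since `X*` has an invertible block and otherwise zero rows. There are finitely
many sign matrices, so in some ball around `(X*, 0)` each step decreases `‖X‖² - ‖Y‖²` by at least a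
fixed amount, while this quantity is bounded on the ball: the iterates have to leave
(`isStronglyUnstable_of_anticommute`). At `(0, Y*)` the same holds with the opposite sign.

This needs all iterates to avoid the set where an entry of `X Yᵀ - M` vanishes. That set is null
(`volume_setOf_mul_transpose_apply_eq`), and each `1 - α L` is invertible unless `α⁻¹` is one of the
finitely many eigenvalues of `L`, so for all other `α` the starting points from which the set can be
reached form a countable union of null sets (`ae_forall_orbit_notMem`).

Local minimality of `(X*, 0)` holds because the entries of `X Yᵀ` in the zero rows of `M` are a pure
loss and, by invertibility of the block of `X*`, control the entries in all other rows with small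
constants (`isLocalMin_rows`). The case of columns follows by exchanging `X` and `Y`.
-/

/-! ### Instability from an anticommuting quadratic form -/

section Abstract

variable {ι : Type*} [Fintype ι]

/-- For symmetric `L` and `J` with `J L = -L J`, the step `z ↦ z - α L z` changes the quadratic form
`z ↦ ⟨J z, z⟩` only by the second order term: the first order term `⟨J z, L z⟩` vanishes. -/
theorem inner_step_of_anticommute {J L : EuclideanSpace ℝ ι →ₗ[ℝ] EuclideanSpace ℝ ι}
    (hJ : J.IsSymmetric) (hL : L.IsSymmetric) (hJL : ∀ z, J (L z) = -L (J z))
    (α : ℝ) (z : EuclideanSpace ℝ ι) :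
    inner ℝ (J (z - α • L z)) (z - α • L z)
      = inner ℝ (J z) z + α ^ 2 * inner ℝ (J (L z)) (L z) := by
  have h1 : inner ℝ (J z) (L z) = (0 : ℝ) := by
    have h2 : inner ℝ (J z) (L z) = inner ℝ (L (J z)) z := (hL _ _).symm
    have h3 : inner ℝ (J (L z)) z = inner ℝ (L z) (J z) := hJ _ _
    rw [hJL, inner_neg_left, ← h2, real_inner_comm (J z) (L z)] at h3
    linarith
  have h4 : inner ℝ (J (L z)) z = (0 : ℝ) := by
    rw [hJ (L z) z, real_inner_comm, h1]
  simp only [map_sub, map_smul, inner_sub_left, inner_sub_right, real_inner_smul_left,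
    real_inner_smul_right, h1, h4]
  ring

/-- `det (1 - α L)` vanishes only if `α⁻¹` is an eigenvalue of `L`. -/
theorem finite_setOf_det_one_sub_smul_eq_zero {E : Type*} [AddCommGroup E] [Module ℝ E]
    [FiniteDimensional ℝ E] (L : E →ₗ[ℝ] E) :
    {α : ℝ | LinearMap.det (1 - α • L) = 0}.Finite := by
  refine ((Module.End.finite_hasEigenvalue L).image (fun μ => μ⁻¹)).subset ?_
  intro α hα
  obtain ⟨v, hv, hv0⟩ := Submodule.exists_mem_ne_zero_of_ne_bot
    (LinearMap.bot_lt_ker_of_det_eq_zero hα).ne'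
  have hv' : v = α • L v := by
    have : v - α • L v = 0 := by simpa using hv
    exact sub_eq_zero.mp this
  have hα0 : α ≠ 0 := by
    rintro rfl
    exact hv0 (by simpa using hv')
  refine ⟨α⁻¹, ?_, inv_inv α⟩
  refine Module.End.hasEigenvalue_of_hasEigenvector (x := v)
    (Module.End.hasEigenvector_iff.mpr ⟨Module.End.mem_eigenspace_iff.mpr ?_, hv0⟩)
  rw [hv', map_smul, inv_smul_smul₀ hα0, ← map_smul, ← hv']

/-- If finitely many maps `z ↦ z - α L z` are all nonsingular, then almost no starting point admits
an orbit that meets a given null set. The orbits choose freely among the maps at each step; what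
they do after having met the null set is not restricted. -/
theorem ae_forall_orbit_notMem {S : Set (EuclideanSpace ℝ ι →ₗ[ℝ] EuclideanSpace ℝ ι)}
    (hS : S.Finite) {N : Set (EuclideanSpace ℝ ι)} (hN : volume N = 0) {α : ℝ}
    (hα : ∀ L ∈ S, LinearMap.det (1 - α • L) ≠ 0) :
    ∀ᵐ x₀ : EuclideanSpace ℝ ι, ∀ x : ℕ → EuclideanSpace ℝ ι, x 0 = x₀ →
      (∀ k, x k ∉ N → ∃ L ∈ S, x (k + 1) = x k - α • L (x k)) → ∀ k, x k ∉ N := by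
  -- `B k` holds the points from which some orbit is in `N` after `k` steps.
  let B : ℕ → Set (EuclideanSpace ℝ ι) := fun k =>
    Nat.rec N (fun _ A => ⋃ L ∈ S, (1 - α • L : EuclideanSpace ℝ ι →ₗ[ℝ] EuclideanSpace ℝ ι) ⁻¹' A) k
  have hB : ∀ k, volume (B k) = 0 := by
    intro k
    induction k with
    | zero => exact hN
    | succ k ih =>
      refine (measure_biUnion_null_iff hS.countable).mpr fun L hL => ?_
      rw [Measure.addHaar_preimage_linearMap _ (hα L hL)]
      exact mul_eq_zero_of_right _ ih
  have hae : ∀ᵐ x₀ : EuclideanSpace ℝ ι, ∀ k, x₀ ∉ B k :=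
    ae_all_iff.mpr fun k => measure_eq_zero_iff_ae_notMem.mp (hB k)
  filter_upwards [hae] with x₀ hx₀ x hx hstep
  subst hx
  have key : ∀ k j, x k ∉ B j := by
    intro k
    induction k with
    | zero => exact hx₀
    | succ k ih =>
      intro j hj
      obtain ⟨L, hL, h⟩ := hstep k (ih 0)
      refine ih (j + 1) (Set.mem_biUnion hL ?_)
      rw [h] at hj
      simpa using hj
  exact fun k => key k 0

/-- Suppose that off a null set the Clarke subgradients of `f` at `z` are among the vectors `L z`,
for `L` in a finite set of symmetric maps that anticommute with a symmetric `J`. If `⟨J L xs, L xs⟩`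
is nonzero with the same sign for all these `L`, then `⟨J z, z⟩` drifts linearly along the iterates
near `xs`, so that they cannot stay near `xs`. -/
theorem isStronglyUnstable_of_anticommute {f : EuclideanSpace ℝ ι → ℝ} {xs : EuclideanSpace ℝ ι}
    (hf : LocallyLipschitz f) {S : Set (EuclideanSpace ℝ ι →ₗ[ℝ] EuclideanSpace ℝ ι)}
    (hS : S.Finite) (hSsymm : ∀ L ∈ S, L.IsSymmetric) {N : Set (EuclideanSpace ℝ ι)}
    (hN : volume N = 0)
    (hsub : ∀ z ∉ N, ∀ s ∈ clarkeSubdifferential f z, ∃ L ∈ S, s = L z)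
    {J : EuclideanSpace ℝ ι →ₗ[ℝ] EuclideanSpace ℝ ι} (hJ : J.IsSymmetric)
    (hJL : ∀ L ∈ S, ∀ z, J (L z) = -L (J z)) {c : ℝ}
    (hc : ∀ L ∈ S, 0 < c * inner ℝ (J (L xs)) (L xs)) :
    IsStronglyUnstable f xs := by
  have hcont : ∀ L : EuclideanSpace ℝ ι →ₗ[ℝ] EuclideanSpace ℝ ι, Continuous L :=
    fun L => L.continuous_of_finiteDimensional
  obtain ⟨δ, hδS, hδ⟩ : ∃ δ : ℝ, (∀ L ∈ S, δ < c * inner ℝ (J (L xs)) (L xs)) ∧ 0 < δ := by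
    have h : ∀ᶠ δ in 𝓝[>] (0 : ℝ), ∀ L ∈ S, δ < c * inner ℝ (J (L xs)) (L xs) :=
      (eventually_all_finite hS).mpr fun L hL =>
        eventually_nhdsWithin_of_eventually_nhds (eventually_lt_nhds (hc L hL))
    exact (h.and self_mem_nhdsWithin).exists
  obtain ⟨ε, hε, hball⟩ : ∃ ε > 0, Metric.closedBall xs ε ⊆
      {z | ∀ L ∈ S, δ < c * inner ℝ (J (L z)) (L z)} := by
    refine Metric.nhds_basis_closedBall.mem_iff.mp
      ((eventually_all_finite hS).mpr fun L hL => ?_)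
    have hcL : Continuous fun z => c * inner ℝ (J (L z)) (L z) :=
      continuous_const.mul (((hcont J).comp (hcont L)).inner (hcont L))
    exact hcL.continuousAt.eventually (eventually_gt_nhds (hδS L hL))
  refine ⟨hf, ε, hε, ?_⟩
  refine (hS.biUnion fun L _ => finite_setOf_det_one_sub_smul_eq_zero L).subset ?_
  rintro α ⟨hα, hbad⟩
  by_contra hdet
  refine hbad ?_
  have hdet' : ∀ L ∈ S, LinearMap.det (1 - α • L) ≠ 0 := fun L hL h =>
    hdet (Set.mem_biUnion hL h)
  filter_upwards [ae_forall_orbit_notMem hS hN hdet'] with x₀ hx₀ _ x hx hseq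
  by_contra! hstay
  have hstep : ∀ k, x k ∉ N → ∃ L ∈ S, x (k + 1) = x k - α • L (x k) := by
    intro k hk
    obtain ⟨s, hs, hxs⟩ := hseq k
    obtain ⟨L, hL, rfl⟩ := hsub _ hk s hs
    exact ⟨L, hL, hxs⟩
  have hgrow : ∀ k : ℕ, c * inner ℝ (J (x 0)) (x 0) + k * (α ^ 2 * δ)
      ≤ c * inner ℝ (J (x k)) (x k) := by
    intro k
    induction k with
    | zero => simp
    | succ k ih =>
      obtain ⟨L, hL, h⟩ := hstep k (hx₀ x hx hstep k)
      have hδk : δ < c * inner ℝ (J (L (x k))) (L (x k)) := hball (hstay k) L hL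
      rw [h, inner_step_of_anticommute hJ (hSsymm L hL) (hJL L hL)]
      have := mul_le_mul_of_nonneg_left hδk.le (sq_nonneg α)
      push_cast
      linarith
  obtain ⟨C, hC⟩ := (isCompact_closedBall xs ε).exists_bound_of_continuousOn
    (f := fun z => c * inner ℝ (J z) z)
    (continuous_const.mul ((hcont J).inner continuous_id)).continuousOn
  obtain ⟨k, hk⟩ := exists_nat_gt ((C - c * inner ℝ (J (x 0)) (x 0)) / (α ^ 2 * δ))
  rw [div_lt_iff₀ (by positivity)] at hk
  have h1 := (le_abs_self _).trans (hC _ (hstay k))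
  have h2 := hgrow k
  linarith

/-- Where `f` agrees near `z` with the quadratic function `w ↦ ⟨L w, w⟩ / 2 + b`, its only
possible Clarke subgradient is the gradient `L z`. -/
theorem eq_of_mem_clarkeSubdifferential_of_quadratic {f : EuclideanSpace ℝ ι → ℝ}
    {L : EuclideanSpace ℝ ι →ₗ[ℝ] EuclideanSpace ℝ ι} (hL : L.IsSymmetric)
    {z s : EuclideanSpace ℝ ι} {b : ℝ} (hf : ∀ᶠ w in 𝓝 z, f w = inner ℝ (L w) w / 2 + b)
    (hs : s ∈ clarkeSubdifferential f z) : s = L z := by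
  have hLc : Continuous L := L.continuous_of_finiteDimensional
  have hdir : ∀ d, clarkeDirDeriv f z d = ((inner ℝ (L z) d : ℝ) : EReal) := by
    intro d
    refine Tendsto.limsup_eq ((continuous_coe_real_ereal.tendsto _).comp ?_)
    have hle : 𝓝 z ×ˢ 𝓝[>] (0 : ℝ) ≤ 𝓝 (z, 0) := by
      rw [nhds_prod_eq]
      exact prod_mono le_rfl nhdsWithin_le_nhds
    have hquot : Tendsto (fun p : EuclideanSpace ℝ ι × ℝ =>
        inner ℝ (L p.1) d + p.2 * (inner ℝ (L d) d / 2)) (𝓝 z ×ˢ 𝓝[>] (0 : ℝ))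
        (𝓝 (inner ℝ (L z) d)) := by
      have hc : Continuous fun p : EuclideanSpace ℝ ι × ℝ =>
          inner ℝ (L p.1) d + p.2 * (inner ℝ (L d) d / 2) := by fun_prop
      simpa using (hc.tendsto (z, (0 : ℝ))).mono_left hle
    refine hquot.congr' ?_
    have h1 : ∀ᶠ p in 𝓝 z ×ˢ 𝓝[>] (0 : ℝ), f p.1 = inner ℝ (L p.1) p.1 / 2 + b :=
      tendsto_fst.eventually hf
    have h2 : ∀ᶠ p in 𝓝 z ×ˢ 𝓝[>] (0 : ℝ), f (p.1 + p.2 • d)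
        = inner ℝ (L (p.1 + p.2 • d)) (p.1 + p.2 • d) / 2 + b := by
      have hc : Continuous fun p : EuclideanSpace ℝ ι × ℝ => p.1 + p.2 • d := by fun_prop
      have ht := (hc.tendsto (z, (0 : ℝ))).mono_left hle
      simp only [zero_smul, add_zero] at ht
      exact ht.eventually hf
    have h3 : ∀ᶠ p in 𝓝 z ×ˢ 𝓝[>] (0 : ℝ), 0 < p.2 :=
      tendsto_snd.eventually self_mem_nhdsWithin
    filter_upwards [h1, h2, h3] with p hp1 hp2 hp3
    have hsymm : inner ℝ (L d) p.1 = inner ℝ (L p.1) d := by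
      rw [hL d p.1, real_inner_comm]
    rw [hp1, hp2, eq_div_iff hp3.ne']
    simp only [map_add, map_smul, inner_add_left, inner_add_right, real_inner_smul_left,
      real_inner_smul_right, hsymm]
    ring
  have hle : ∀ d, inner ℝ s d ≤ inner ℝ (L z) d := fun d => by
    have h := hs d
    rw [hdir d] at h
    exact_mod_cast h
  refine ext_inner_right ℝ fun d => le_antisymm (hle d) ?_
  have h := hle (-d)
  simp only [inner_neg_right] at h
  linarith

end Abstract

/-! ### The gradients of the robust PCA objective -/

section Factorization

variable {m n r : ℕ}

@[simp] theorem factorX_factorPair (X : Matrix (Fin m) (Fin r) ℝ) (Y : Matrix (Fin n) (Fin r) ℝ) :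
    factorX (factorPair X Y) = X := rfl

@[simp] theorem factorY_factorPair (X : Matrix (Fin m) (Fin r) ℝ) (Y : Matrix (Fin n) (Fin r) ℝ) :
    factorY (factorPair X Y) = Y := rfl

theorem factorSpace_ext {z w : FactorSpace m n r} (hX : factorX z = factorX w)
    (hY : factorY z = factorY w) : z = w := by
  ext (⟨i, k⟩ | ⟨j, k⟩)
  · exact congrFun₂ hX i k
  · exact congrFun₂ hY j k

theorem continuous_factorX : Continuous (factorX : FactorSpace m n r → _) :=
  continuous_matrix fun i k => by unfold factorX; simp only [Matrix.of_apply]; fun_prop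

theorem continuous_factorY : Continuous (factorY : FactorSpace m n r → _) :=
  continuous_matrix fun i k => by unfold factorY; simp only [Matrix.of_apply]; fun_prop

theorem inner_factorSpace (z w : FactorSpace m n r) :
    inner ℝ z w = ∑ i, ∑ k, factorX z i k * factorX w i k
      + ∑ j, ∑ k, factorY z j k * factorY w j k := by
  simp [PiLp.inner_apply, Fintype.sum_sum_type, Fintype.sum_prod_type, factorX, factorY, mul_comm]

/-- The set of `m × n` matrices with all entries `1` or `-1`. -/
def signMatrices (m n : ℕ) : Set (Matrix (Fin m) (Fin n) ℝ) :=
  {Λ | ∀ i j, Λ i j = 1 ∨ Λ i j = -1}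

theorem finite_signMatrices (m n : ℕ) : (signMatrices m n).Finite := by
  have h : (Set.univ.pi fun _ : Fin m => Set.univ.pi fun _ : Fin n => ({1, -1} : Set ℝ)).Finite :=
    Set.Finite.pi fun _ => Set.Finite.pi fun _ => by simp
  exact h.subset fun Λ hΛ i _ j _ => hΛ i j

/-- The linear map `(X, Y) ↦ (Λ Y, Λᵀ X)`. It is the gradient of `(X, Y) ↦ ∑ Λᵢⱼ (X Yᵀ)ᵢⱼ`. -/
def gradMap (Λ : Matrix (Fin m) (Fin n) ℝ) : FactorSpace m n r →ₗ[ℝ] FactorSpace m n r where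
  toFun z := factorPair (Λ * factorY z) (Λ.transpose * factorX z)
  map_add' z w := factorSpace_ext (Matrix.mul_add Λ (factorY z) (factorY w))
    (Matrix.mul_add Λ.transpose (factorX z) (factorX w))
  map_smul' a z := factorSpace_ext (Matrix.mul_smul Λ a (factorY z))
    (Matrix.mul_smul Λ.transpose a (factorX z))

/-- The linear map `(X, Y) ↦ (X, -Y)`; its quadratic form is `‖X‖² - ‖Y‖²`. -/
def negSndMap : FactorSpace m n r →ₗ[ℝ] FactorSpace m n r where
  toFun z := factorPair (factorX z) (-factorY z)
  map_add' z w := factorSpace_ext rfl (neg_add (factorY z) (factorY w))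
  map_smul' a z := factorSpace_ext rfl (smul_neg a (factorY z)).symm

@[simp] theorem gradMap_apply (Λ : Matrix (Fin m) (Fin n) ℝ) (z : FactorSpace m n r) :
    gradMap Λ z = factorPair (Λ * factorY z) (Λ.transpose * factorX z) := rfl

@[simp] theorem negSndMap_apply (z : FactorSpace m n r) :
    negSndMap z = factorPair (factorX z) (-factorY z) := rfl

theorem negSndMap_isSymmetric : (negSndMap (m := m) (n := n) (r := r)).IsSymmetric := fun z w => by
  simp [inner_factorSpace]

theorem negSndMap_gradMap (Λ : Matrix (Fin m) (Fin n) ℝ) (z : FactorSpace m n r) :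
    negSndMap (gradMap Λ z) = -gradMap Λ (negSndMap z) := by
  rw [← map_neg]
  refine factorSpace_ext ?_ ?_
  · exact congrArg (Λ * ·) (neg_neg (factorY z)).symm
  · exact (Matrix.mul_neg Λ.transpose (factorX z)).symm

theorem inner_gradMap (Λ : Matrix (Fin m) (Fin n) ℝ) (z w : FactorSpace m n r) :
    inner ℝ (gradMap Λ z) w = ∑ i, ∑ j, Λ i j * ((factorX w * (factorY z).transpose) i j
      + (factorX z * (factorY w).transpose) i j) := by
  rw [inner_factorSpace]
  simp only [gradMap_apply, factorX_factorPair, factorY_factorPair, Matrix.mul_apply,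
    Matrix.transpose_apply, mul_add, Finset.sum_add_distrib, Finset.mul_sum, Finset.sum_mul]
  congr 1
  · refine Finset.sum_congr rfl fun i _ => ?_
    rw [Finset.sum_comm]
    exact Finset.sum_congr rfl fun j _ => Finset.sum_congr rfl fun k _ => by ring
  · conv_rhs => rw [Finset.sum_comm]
    refine Finset.sum_congr rfl fun j _ => ?_
    rw [Finset.sum_comm]
    exact Finset.sum_congr rfl fun i _ => Finset.sum_congr rfl fun k _ => by ring

theorem gradMap_isSymmetric (Λ : Matrix (Fin m) (Fin n) ℝ) :
    (gradMap (r := r) Λ).IsSymmetric := fun z w => by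
  rw [real_inner_comm (gradMap Λ w) z, inner_gradMap, inner_gradMap]
  simp only [add_comm]

theorem continuous_mul_transpose_apply (i : Fin m) (j : Fin n) :
    Continuous fun z : FactorSpace m n r => (factorX z * (factorY z).transpose) i j :=
  (continuous_factorX.matrix_mul continuous_factorY.matrix_transpose).matrix_elem i j

/-- Near a point with no vanishing residual, the objective is the quadratic function given by the
signs of the residuals. -/
theorem exists_eventually_rpcaObjective_eq (M : Matrix (Fin m) (Fin n) ℝ) {z : FactorSpace m n r}
    (hz : ∀ i j, (factorX z * (factorY z).transpose) i j ≠ M i j) :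
    ∃ Λ ∈ signMatrices m n, ∀ᶠ w in 𝓝 z,
      rpcaObjective M w = inner ℝ (gradMap Λ w) w / 2 + -∑ i, ∑ j, Λ i j * M i j := by
  let R : FactorSpace m n r → Matrix (Fin m) (Fin n) ℝ :=
    fun w => factorX w * (factorY w).transpose - M
  have hR : ∀ i j, Continuous fun w => R w i j := fun i j =>
    (continuous_mul_transpose_apply i j).sub continuous_const
  have hR0 : ∀ i j, R z i j ≠ 0 := fun i j => sub_ne_zero.mpr (hz i j)
  let Λ : Matrix (Fin m) (Fin n) ℝ := fun i j => if 0 < R z i j then 1 else -1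
  have habs : ∀ i j, ∀ᶠ w in 𝓝 z, |R w i j| = Λ i j * R w i j := by
    intro i j
    by_cases h : 0 < R z i j
    · filter_upwards [(hR i j).continuousAt.eventually (eventually_gt_nhds h)] with w hw
      simp [Λ, h, abs_of_pos hw]
    · have h' : R z i j < 0 := lt_of_le_of_ne (not_lt.mp h) (hR0 i j)
      filter_upwards [(hR i j).continuousAt.eventually (eventually_lt_nhds h')] with w hw
      simp [Λ, h, abs_of_neg hw]
  refine ⟨Λ, fun i j => by by_cases h : 0 < R z i j <;> simp [Λ, h], ?_⟩
  filter_upwards [eventually_all.mpr fun i => eventually_all.mpr (habs i)] with w hw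
  have h1 : rpcaObjective M w = ∑ i, ∑ j, Λ i j * R w i j :=
    Finset.sum_congr rfl fun i _ => Finset.sum_congr rfl fun j _ => hw i j
  rw [h1, inner_gradMap, Finset.sum_div, ← sub_eq_add_neg, ← Finset.sum_sub_distrib]
  refine Finset.sum_congr rfl fun i _ => ?_
  rw [Finset.sum_div, ← Finset.sum_sub_distrib]
  refine Finset.sum_congr rfl fun j _ => ?_
  simp only [R, Matrix.sub_apply]
  ring

/-- Along a line in the direction of one coordinate of row `i` of `X` plus the same coordinate of
row `j` of `Y`, the entry `(X Yᵀ)ᵢⱼ` is a monic quadratic polynomial, so its level sets meet every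
such line in finitely many points. -/
theorem volume_setOf_mul_transpose_apply_eq (hr : 1 ≤ r) (i : Fin m) (j : Fin n) (a : ℝ) :
    volume {z : FactorSpace m n r | (factorX z * (factorY z).transpose) i j = a} = 0 := by
  let k₀ : Fin r := ⟨0, hr⟩
  let v : FactorSpace m n r := factorPair (Matrix.single i k₀ 1) (Matrix.single j k₀ 1)
  have hclosed : IsClosed {z : FactorSpace m n r | (factorX z * (factorY z).transpose) i j = a} :=
    isClosed_eq (continuous_mul_transpose_apply i j) continuous_const
  refine measure_eq_zero_iff_ae_notMem.mpr ?_
  refine ae_mem_of_ae_add_linearMap_mem (LinearMap.toSpanSingleton ℝ (FactorSpace m n r) v)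
    volume volume hclosed.measurableSet.compl fun y => ?_
  have hline : ∀ t : ℝ,
      (factorX (y + t • v) * (factorY (y + t • v)).transpose) i j
        = (factorX y * (factorY y).transpose) i j
          + t * (factorX y i k₀ + factorY y j k₀) + t ^ 2 := by
    intro t
    have hX : factorX (y + t • v) = factorX y + t • Matrix.single i k₀ 1 := rfl
    have hY : factorY (y + t • v) = factorY y + t • Matrix.single j k₀ 1 := rfl
    rw [hX, hY]
    simp [Matrix.add_mul, Matrix.mul_add]
    ring
  have hfin : {t : ℝ | (factorX (y + t • v) * (factorY (y + t • v)).transpose) i j = a}.Finite := by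
    let b := factorX y i k₀ + factorY y j k₀
    let c := (factorX y * (factorY y).transpose) i j - a
    let p : Polynomial ℝ := Polynomial.X ^ 2 + (Polynomial.C b * Polynomial.X + Polynomial.C c)
    have hp : p ≠ 0 := (Polynomial.monic_X_pow_add
      ((Polynomial.degree_linear_le).trans_lt (by norm_num))).ne_zero
    refine (Polynomial.finite_setOfPred_isRoot hp).subset fun t ht => ?_
    have ht' := hline t
    rw [Set.mem_ofPred_eq] at ht
    rw [ht] at ht'
    simp only [Set.mem_ofPred_eq, Polynomial.IsRoot, p, b, c, Polynomial.eval_add,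
      Polynomial.eval_pow, Polynomial.eval_X, Polynomial.eval_mul, Polynomial.eval_C]
    linarith
  exact measure_eq_zero_iff_ae_notMem.mp (hfin.measure_zero volume)

theorem locallyLipschitz_rpcaObjective (M : Matrix (Fin m) (Fin n) ℝ) :
    LocallyLipschitz (rpcaObjective (r := r) M) := by
  have h : rpcaObjective (r := r) M = (fun v : PiLp 1 fun _ : Fin m × Fin n => ℝ => ‖v‖) ∘
      fun z => WithLp.toLp 1 fun p : Fin m × Fin n =>
        ∑ k, z (Sum.inl (p.1, k)) * z (Sum.inr (p.2, k)) - M p.1 p.2 := by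
    ext z
    simp [rpcaObjective, PiLp.norm_eq_of_L1, Fintype.sum_prod_type, Matrix.mul_apply, factorX,
      factorY]
  rw [h]
  refine lipschitzWith_one_norm.locallyLipschitz.comp
    (ContDiff.locallyLipschitz (𝕂 := ℝ) ((contDiff_piLp 1).mpr fun p => ?_))
  fun_prop

/-- `(X, Y)` is strongly unstable if `‖Λ Y‖ < ‖Λᵀ X‖` for all sign matrices `Λ` (with `c = -1`), or
`‖Λᵀ X‖ < ‖Λ Y‖` for all of them (with `c = 1`). -/
theorem isStronglyUnstable_rpcaObjective (hr : 1 ≤ r) (M : Matrix (Fin m) (Fin n) ℝ)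
    {xs : FactorSpace m n r} {c : ℝ}
    (hc : ∀ Λ ∈ signMatrices m n,
      0 < c * inner ℝ (negSndMap (gradMap Λ xs)) (gradMap Λ xs)) :
    IsStronglyUnstable (rpcaObjective M) xs := by
  refine isStronglyUnstable_of_anticommute (locallyLipschitz_rpcaObjective M)
    (S := gradMap '' signMatrices m n)
    (N := ⋃ i, ⋃ j, {z | (factorX z * (factorY z).transpose) i j = M i j}) (J := negSndMap)
    ((finite_signMatrices m n).image _) ?_ ?_ ?_ negSndMap_isSymmetric ?_ (c := c) ?_
  · rintro _ ⟨Λ, -, rfl⟩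
    exact gradMap_isSymmetric Λ
  · exact measure_iUnion_null fun i => measure_iUnion_null fun j =>
      volume_setOf_mul_transpose_apply_eq hr i j _
  · intro z hz s hs
    simp only [Set.mem_iUnion, Set.mem_ofPred_eq, not_exists] at hz
    obtain ⟨Λ, hΛ, hev⟩ := exists_eventually_rpcaObjective_eq M hz
    exact ⟨_, ⟨Λ, hΛ, rfl⟩,
      eq_of_mem_clarkeSubdifferential_of_quadratic (gradMap_isSymmetric Λ) hev hs⟩
  · rintro _ ⟨Λ, -, rfl⟩ z
    exact negSndMap_gradMap Λ z
  · rintro _ ⟨Λ, hΛ, rfl⟩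
    exact hc Λ hΛ

theorem vecMul_ne_zero_of_isUnit_submatrix (hr : 1 ≤ r) {X : Matrix (Fin m) (Fin r) ℝ}
    {e : Fin r ↪ Fin m} (hX : IsUnit (X.submatrix e id)) (hX0 : ∀ i ∉ Set.range e, ∀ k, X i k = 0)
    {u : Fin m → ℝ} (hu : ∀ i, u i ≠ 0) : Matrix.vecMul u X ≠ 0 := by
  intro h
  have h1 : Matrix.vecMul (u ∘ e) (X.submatrix e id) = 0 := by
    ext k
    have hk := congrFun h k
    simp only [Matrix.vecMul, dotProduct, Pi.zero_apply] at hk ⊢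
    rw [← hk]
    refine Finset.sum_of_injOn e e.injective.injOn (by simp) (fun i _ hi => ?_) fun l _ => rfl
    rw [hX0 i (by simpa using hi) k, mul_zero]
  have h2 : u ∘ e = 0 := Matrix.vecMul_injective_of_isUnit hX (by simpa using h1)
  exact hu _ (congrFun h2 ⟨0, hr⟩)

theorem isStronglyUnstable_rows (hr : 1 ≤ r) (M : Matrix (Fin m) (Fin n) ℝ) (hM : M ≠ 0)
    {e : Fin r ↪ Fin m} {X : Matrix (Fin m) (Fin r) ℝ} (hX : IsUnit (X.submatrix e id))
    (hX0 : ∀ i ∉ Set.range e, ∀ k, X i k = 0) :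
    IsStronglyUnstable (rpcaObjective M) (factorPair X (0 : Matrix (Fin n) (Fin r) ℝ)) := by
  obtain ⟨j₀⟩ : Nonempty (Fin n) := by
    by_contra hn
    exact hM (Matrix.ext fun i j => (hn ⟨j⟩).elim)
  refine isStronglyUnstable_rpcaObjective hr M (c := -1) fun Λ hΛ => ?_
  have hne : gradMap Λ (factorPair X (0 : Matrix (Fin n) (Fin r) ℝ)) ≠ 0 := by
    intro h
    refine vecMul_ne_zero_of_isUnit_submatrix hr hX hX0 (u := fun i => Λ i j₀)
      (fun i => by rcases hΛ i j₀ with h | h <;> simp [h]) ?_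
    exact congrFun (congrArg factorY h) j₀
  have hneg : negSndMap (gradMap Λ (factorPair X (0 : Matrix (Fin n) (Fin r) ℝ)))
      = -gradMap Λ (factorPair X (0 : Matrix (Fin n) (Fin r) ℝ)) := by
    rw [negSndMap_gradMap]
    simp
  rw [hneg, inner_neg_left, neg_one_mul, neg_neg]
  exact real_inner_self_pos.mpr hne

theorem isStronglyUnstable_columns (hr : 1 ≤ r) (M : Matrix (Fin m) (Fin n) ℝ) (hM : M ≠ 0)
    {e : Fin r ↪ Fin n} {Y : Matrix (Fin n) (Fin r) ℝ} (hY : IsUnit (Y.submatrix e id))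
    (hY0 : ∀ j ∉ Set.range e, ∀ k, Y j k = 0) :
    IsStronglyUnstable (rpcaObjective M) (factorPair (0 : Matrix (Fin m) (Fin r) ℝ) Y) := by
  obtain ⟨i₀⟩ : Nonempty (Fin m) := by
    by_contra hn
    exact hM (Matrix.ext fun i j => (hn ⟨i⟩).elim)
  refine isStronglyUnstable_rpcaObjective hr M (c := 1) fun Λ hΛ => ?_
  have hne : gradMap Λ (factorPair (0 : Matrix (Fin m) (Fin r) ℝ) Y) ≠ 0 := by
    intro h
    refine vecMul_ne_zero_of_isUnit_submatrix hr hY hY0 (u := Λ i₀)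
      (fun j => by rcases hΛ i₀ j with h | h <;> simp [h]) ?_
    exact congrFun (congrArg factorX h) i₀
  have hfix : negSndMap (gradMap Λ (factorPair (0 : Matrix (Fin m) (Fin r) ℝ) Y))
      = gradMap Λ (factorPair (0 : Matrix (Fin m) (Fin r) ℝ) Y) := by
    simp
  rw [hfix, one_mul]
  exact real_inner_self_pos.mpr hne

end Factorization

/-! ### Spurious local minima -/

section SpuriousLocalMin

variable {m n r : ℕ}

/-- Here `p` and `a` stand for corresponding columns of `X Yᵀ` and `M`. The loss `∑ |p (e k)|` in the
coordinates where `a` vanishes outweighs whatever can be gained in the others, of which there are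
at most `m`. -/
theorem sum_abs_le_sum_abs_sub {e : Fin r ↪ Fin m} {p a : Fin m → ℝ} (ha : ∀ k, a (e k) = 0)
    (hp : ∀ i ∉ Set.range e, m * |p i| ≤ ∑ k, |p (e k)|) :
    ∑ i, |a i| ≤ ∑ i, |p i - a i| := by
  classical
  let R : Finset (Fin m) := Finset.univ.map e
  have hR : ∀ g : Fin m → ℝ, ∑ i ∈ R, g i = ∑ k, g (e k) := fun g => Finset.sum_map _ _ _
  have hoff : ∑ i ∈ Rᶜ, |p i| ≤ ∑ k, |p (e k)| := by
    rcases Nat.eq_zero_or_pos m with rfl | hm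
    · simp only [Finset.eq_empty_of_isEmpty, Finset.sum_empty]
      positivity
    have hm' : (0 : ℝ) < m := by exact_mod_cast hm
    have h1 : ∀ i ∈ Rᶜ, |p i| ≤ (∑ k, |p (e k)|) / m := fun i hi => by
      rw [le_div_iff₀' hm']
      exact hp i (by simpa [R] using hi)
    refine (Finset.sum_le_card_nsmul _ _ _ h1).trans ?_
    rw [nsmul_eq_mul, ← mul_div_assoc, div_le_iff₀ hm', mul_comm]
    refine mul_le_mul_of_nonneg_left ?_ (by positivity)
    exact_mod_cast (Finset.card_le_univ _).trans_eq (Fintype.card_fin m)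
  have h2 : ∑ i ∈ Rᶜ, |a i| - ∑ i ∈ Rᶜ, |p i| ≤ ∑ i ∈ Rᶜ, |p i - a i| := by
    rw [← Finset.sum_sub_distrib]
    refine Finset.sum_le_sum fun i _ => ?_
    rw [abs_sub_comm]
    exact abs_sub_abs_le_abs_sub _ _
  rw [← Finset.sum_add_sum_compl R, ← Finset.sum_add_sum_compl R fun i => |p i - a i|, hR, hR]
  simp only [ha, sub_zero, abs_zero, Finset.sum_const_zero]
  linarith

/-- With `A` the square block of the rows `e k` of `X`, `det A • X = (X * adj A) * A` expresses all
rows of `X Yᵀ` through the rows `e k`; near the given point the coefficients `X * adj A` in the other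
rows are small compared to `det A`. -/
theorem isLocalMin_rows (M : Matrix (Fin m) (Fin n) ℝ) {e : Fin r ↪ Fin m}
    (he : ∀ k j, M (e k) j = 0) {X : Matrix (Fin m) (Fin r) ℝ} (hX : IsUnit (X.submatrix e id))
    (hX0 : ∀ i ∉ Set.range e, ∀ k, X i k = 0) :
    IsLocalMin (rpcaObjective M) (factorPair X (0 : Matrix (Fin n) (Fin r) ℝ)) := by
  let A : FactorSpace m n r → Matrix (Fin r) (Fin r) ℝ := fun z => (factorX z).submatrix e id
  have hA : Continuous A := continuous_factorX.matrix_submatrix _ _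
  let W : FactorSpace m n r → Matrix (Fin m) (Fin r) ℝ := fun z => factorX z * (A z).adjugate
  have hW : Continuous W := continuous_factorX.matrix_mul hA.matrix_adjugate
  have hdet : 0 < |(X.submatrix e id).det| :=
    abs_pos.mpr ((Matrix.isUnit_iff_isUnit_det _).mp hX).ne_zero
  have hev : ∀ᶠ z in 𝓝 (factorPair X (0 : Matrix (Fin n) (Fin r) ℝ)),
      ∀ i, i ∉ Set.range e → ∀ k, m * |W z i k| < |(A z).det| := by
    refine eventually_all.mpr fun i => ?_
    by_cases hi : i ∈ Set.range e
    · exact Eventually.of_forall fun z h => (h hi).elim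
    refine (eventually_all.mpr fun k => ?_).mono fun z hz _ => hz
    have h0 : W (factorPair X 0) i k = 0 := by
      simp [W, Matrix.mul_apply, hX0 i hi]
    refine ContinuousAt.eventually_lt (continuous_const.mul (hW.matrix_elem i k).abs).continuousAt
      hA.matrix_det.abs.continuousAt ?_
    simpa [h0, A] using hdet
  have hev' : ∀ᶠ z in 𝓝 (factorPair X (0 : Matrix (Fin n) (Fin r) ℝ)), 0 < |(A z).det| :=
    hA.matrix_det.abs.continuousAt.eventually (eventually_gt_nhds hdet)
  filter_upwards [hev, hev'] with z hz hz'
  have hstar : rpcaObjective M (factorPair X (0 : Matrix (Fin n) (Fin r) ℝ))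
      = ∑ j, ∑ i, |M i j| := by
    rw [Finset.sum_comm]
    simp [rpcaObjective]
  have hobj : rpcaObjective M z
      = ∑ j, ∑ i, |(factorX z * (factorY z).transpose) i j - M i j| := by
    rw [Finset.sum_comm]
    rfl
  rw [hstar, hobj]
  refine Finset.sum_le_sum fun j _ => sum_abs_le_sum_abs_sub (e := e) (fun k => he k j) ?_
  intro i hi
  let P : Matrix (Fin m) (Fin n) ℝ := factorX z * (factorY z).transpose
  have hcramer : (A z).det * P i j = ∑ k, W z i k * P (e k) j := by
    have h1 : (A z).det • P = W z * (A z * (factorY z).transpose) := by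
      simp only [W, P]
      rw [Matrix.mul_assoc, ← Matrix.mul_assoc (A z).adjugate, Matrix.adjugate_mul,
        Matrix.smul_mul, Matrix.one_mul, Matrix.mul_smul]
    exact congrFun₂ h1 i j
  have hbound : |(A z).det| * (m * |P i j|) ≤ |(A z).det| * ∑ k, |P (e k) j| := by
    calc |(A z).det| * (m * |P i j|) = m * |∑ k, W z i k * P (e k) j| := by
          rw [← hcramer, abs_mul]; ring
      _ ≤ m * ∑ k, |W z i k| * |P (e k) j| := by
          refine mul_le_mul_of_nonneg_left ?_ (by positivity)
          simpa only [abs_mul] using Finset.abs_sum_le_sum_abs (fun k => W z i k * P (e k) j) _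
      _ ≤ |(A z).det| * ∑ k, |P (e k) j| := by
          rw [Finset.mul_sum, Finset.mul_sum]
          refine Finset.sum_le_sum fun k _ => ?_
          rw [← mul_assoc]
          exact mul_le_mul_of_nonneg_right (hz i hi k).le (abs_nonneg _)
  exact le_of_mul_le_mul_left hbound hz'

/-- Matching a single nonzero entry of `M` by a matrix of rank one improves on `X Yᵀ = 0`. -/
theorem exists_rpcaObjective_lt (hr : 1 ≤ r) {M : Matrix (Fin m) (Fin n) ℝ} (hM : M ≠ 0)
    {z : FactorSpace m n r} (hz : factorX z * (factorY z).transpose = 0) :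
    ∃ y : FactorSpace m n r, rpcaObjective M y < rpcaObjective M z := by
  obtain ⟨i₀, j₀, h₀⟩ : ∃ i j, M i j ≠ 0 := by
    by_contra! h
    exact hM (Matrix.ext h)
  let k₀ : Fin r := ⟨0, hr⟩
  refine ⟨factorPair (Matrix.single i₀ k₀ (M i₀ j₀)) (Matrix.single j₀ k₀ 1), ?_⟩
  simp only [rpcaObjective, factorX_factorPair, factorY_factorPair, Matrix.transpose_single, hz,
    Matrix.single_mul_single_same, mul_one, Matrix.sub_apply, Matrix.zero_apply, zero_sub, abs_neg]
  have hle : ∀ i j, |Matrix.single i₀ j₀ (M i₀ j₀) i j - M i j| ≤ |M i j| := by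
    intro i j
    by_cases h : i₀ = i ∧ j₀ = j
    · obtain ⟨rfl, rfl⟩ := h
      simp
    · simp [Matrix.single_apply_of_ne _ _ _ _ _ h]
  refine Finset.sum_lt_sum (fun i _ => Finset.sum_le_sum fun j _ => hle i j)
    ⟨i₀, Finset.mem_univ _, Finset.sum_lt_sum (fun j _ => hle i₀ j) ⟨j₀, Finset.mem_univ _, ?_⟩⟩
  simpa using h₀

/-- Exchanging the two factors turns the objective for `M` into the one for `Mᵀ`. -/
theorem rpcaObjective_transpose_swap (M : Matrix (Fin m) (Fin n) ℝ) (z : FactorSpace m n r) :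
    rpcaObjective M.transpose (factorPair (factorY z) (factorX z)) = rpcaObjective M z := by
  unfold rpcaObjective
  rw [Finset.sum_comm]
  refine Finset.sum_congr rfl fun i _ => Finset.sum_congr rfl fun j _ => ?_
  simp [Matrix.mul_apply, mul_comm]

theorem isLocalMin_columns (M : Matrix (Fin m) (Fin n) ℝ) {e : Fin r ↪ Fin n}
    (he : ∀ i k, M i (e k) = 0) {Y : Matrix (Fin n) (Fin r) ℝ} (hY : IsUnit (Y.submatrix e id))
    (hY0 : ∀ j ∉ Set.range e, ∀ k, Y j k = 0) :
    IsLocalMin (rpcaObjective M) (factorPair (0 : Matrix (Fin m) (Fin r) ℝ) Y) := by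
  let swap : FactorSpace m n r → FactorSpace n m r := fun z => factorPair (factorY z) (factorX z)
  have hswap : Continuous swap := by
    refine (PiLp.continuous_toLp 2 _).comp (continuous_pi ?_)
    rintro (⟨j, k⟩ | ⟨i, k⟩)
    · exact continuous_factorY.matrix_elem j k
    · exact continuous_factorX.matrix_elem i k
  have hmin : IsLocalMin (rpcaObjective M.transpose) (swap (factorPair 0 Y)) :=
    isLocalMin_rows M.transpose (fun k i => he i k) hY hY0
  have hcomp := IsMinFilter.comp_tendsto hmin (hswap.tendsto (factorPair 0 Y))
  have heq : rpcaObjective M.transpose ∘ swap = rpcaObjective M :=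
    funext (rpcaObjective_transpose_swap M)
  rwa [heq] at hcomp

theorem isSpuriousLocalMin_rows (hr : 1 ≤ r) (M : Matrix (Fin m) (Fin n) ℝ) (hM : M ≠ 0)
    {e : Fin r ↪ Fin m} (he : ∀ k j, M (e k) j = 0) {X : Matrix (Fin m) (Fin r) ℝ}
    (hX : IsUnit (X.submatrix e id)) (hX0 : ∀ i ∉ Set.range e, ∀ k, X i k = 0) :
    IsSpuriousLocalMin (rpcaObjective M) (factorPair X (0 : Matrix (Fin n) (Fin r) ℝ)) :=
  ⟨isLocalMin_rows M he hX hX0, exists_rpcaObjective_lt hr hM (by simp)⟩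

theorem isSpuriousLocalMin_columns (hr : 1 ≤ r) (M : Matrix (Fin m) (Fin n) ℝ) (hM : M ≠ 0)
    {e : Fin r ↪ Fin n} (he : ∀ i k, M i (e k) = 0) {Y : Matrix (Fin n) (Fin r) ℝ}
    (hY : IsUnit (Y.submatrix e id)) (hY0 : ∀ j ∉ Set.range e, ∀ k, Y j k = 0) :
    IsSpuriousLocalMin (rpcaObjective M) (factorPair (0 : Matrix (Fin m) (Fin r) ℝ) Y) :=
  ⟨isLocalMin_columns M he hY hY0, exists_rpcaObjective_lt hr hM (by simp)⟩

theorem exists_embedding_of_le_ncard {s : Set (Fin m)} (h : r ≤ s.ncard) :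
    ∃ e : Fin r ↪ Fin m, ∀ k, e k ∈ s := by
  have hcard : Fintype.card (Fin r) ≤ Nat.card s := by simpa using h
  have : Fintype s := Fintype.ofFinite s
  rw [Nat.card_eq_fintype_card] at hcard
  obtain ⟨e⟩ := Function.Embedding.nonempty_of_card_le hcard
  exact ⟨e.trans (Function.Embedding.subtype _), fun k => (e k).2⟩

/-- The rows `e k` may be taken to form the identity matrix. -/
theorem exists_isUnit_submatrix (e : Fin r ↪ Fin m) :
    ∃ X : Matrix (Fin m) (Fin r) ℝ,
      IsUnit (X.submatrix e id) ∧ ∀ i ∉ Set.range e, ∀ k, X i k = 0 := by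
  refine ⟨Matrix.of fun i k => if i = e k then 1 else 0, ?_, ?_⟩
  · convert isUnit_one
    ext l k
    simp [Matrix.one_apply, e.injective.eq_iff]
  · intro i hi k
    have : i ≠ e k := fun h => hi ⟨k, h.symm⟩
    simp [this]

end SpuriousLocalMin

theorem mainTheorem6 {m n r : ℕ} (hr : 1 ≤ r) (M : Matrix (Fin m) (Fin n) ℝ) (hM : M ≠ 0)
    (hzero : r ≤ {i : Fin m | ∀ j, M i j = 0}.ncard ∨ r ≤ {j : Fin n | ∀ i, M i j = 0}.ncard) :
    (∃ z : FactorSpace m n r,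
      IsSpuriousLocalMin (rpcaObjective M) z ∧ IsStronglyUnstable (rpcaObjective M) z) ∧
    (∀ e : Fin r ↪ Fin m, (∀ k j, M (e k) j = 0) →
      ∀ X : Matrix (Fin m) (Fin r) ℝ, IsUnit (X.submatrix e id) →
        (∀ i ∉ Set.range e, ∀ k, X i k = 0) →
        IsSpuriousLocalMin (rpcaObjective M) (factorPair X (0 : Matrix (Fin n) (Fin r) ℝ)) ∧
        IsStronglyUnstable (rpcaObjective M) (factorPair X (0 : Matrix (Fin n) (Fin r) ℝ))) ∧
    (∀ e : Fin r ↪ Fin n, (∀ i k, M i (e k) = 0) →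
      ∀ Y : Matrix (Fin n) (Fin r) ℝ, IsUnit (Y.submatrix e id) →
        (∀ j ∉ Set.range e, ∀ k, Y j k = 0) →
        IsSpuriousLocalMin (rpcaObjective M) (factorPair (0 : Matrix (Fin m) (Fin r) ℝ) Y) ∧
        IsStronglyUnstable (rpcaObjective M) (factorPair (0 : Matrix (Fin m) (Fin r) ℝ) Y)) := by
  have hrows : ∀ e : Fin r ↪ Fin m, (∀ k j, M (e k) j = 0) →
      ∀ X : Matrix (Fin m) (Fin r) ℝ, IsUnit (X.submatrix e id) →
        (∀ i ∉ Set.range e, ∀ k, X i k = 0) →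
        IsSpuriousLocalMin (rpcaObjective M) (factorPair X (0 : Matrix (Fin n) (Fin r) ℝ)) ∧
        IsStronglyUnstable (rpcaObjective M) (factorPair X (0 : Matrix (Fin n) (Fin r) ℝ)) :=
    fun e he X hX hX0 =>
      ⟨isSpuriousLocalMin_rows hr M hM he hX hX0, isStronglyUnstable_rows hr M hM hX hX0⟩
  have hcols : ∀ e : Fin r ↪ Fin n, (∀ i k, M i (e k) = 0) →
      ∀ Y : Matrix (Fin n) (Fin r) ℝ, IsUnit (Y.submatrix e id) →
        (∀ j ∉ Set.range e, ∀ k, Y j k = 0) →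
        IsSpuriousLocalMin (rpcaObjective M) (factorPair (0 : Matrix (Fin m) (Fin r) ℝ) Y) ∧
        IsStronglyUnstable (rpcaObjective M) (factorPair (0 : Matrix (Fin m) (Fin r) ℝ) Y) :=
    fun e he Y hY hY0 =>
      ⟨isSpuriousLocalMin_columns hr M hM he hY hY0, isStronglyUnstable_columns hr M hM hY hY0⟩
  refine ⟨?_, hrows, hcols⟩
  rcases hzero with h | h
  · obtain ⟨e, he⟩ := exists_embedding_of_le_ncard h
    obtain ⟨X, hX, hX0⟩ := exists_isUnit_submatrix e
    exact ⟨_, hrows e he X hX hX0⟩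
  · obtain ⟨e, he⟩ := exists_embedding_of_le_ncard h
    obtain ⟨Y, hY, hY0⟩ := exists_isUnit_submatrix e
    exact ⟨_, hcols e (fun i k => he k i) Y hY hY0⟩
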